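/- For a positive integer $n$ let $S_n$ be the set of permutations of $\{1,\dots,n\}$ with the infinity metric $d(f,g)=\max_{1\le i\le n}|f(i)-g(i)|$, and let $|B_{r,n}|$ denote the number of $g\in S_n$ with $d(f,g)\le r$ (this number does not depend on the centre $f\in S_n$). For $z\ge 0$ let $W(z)$ be the Lambert function, i.e. the unique real number with $W(z)e^{W(z)}=z$. Fix a constant $\rho$ with $\tfrac12<\rho<1$, and put $$\hat t=\log_2(e)\cdot\left(\frac{2(1-\rho)}{2\rho-1}-W\!\left(\frac{(1-\rho)\,\exp\!\left(\frac{2(1-\rho)}{2\rho-1}\right)}{2\rho-1}\right)\right).$$ Then there is a positive function $\varphi_3(\rho,n)$ of $n$ with $$\log_2\varphi_3(\rho,n)=n\log_2 n-n\left[\log_2\!\left(\frac{e\,\hat t}{\log_2 e}\right)-\hat t\,(2\rho-1)-\log_2(1-\rho)\right]+o(n)\qquad(n\to\infty)$$ such that, for every positive integer $n$ for which $r=\rho(n-1)$ is an integer, $$|B_{r,n}|\ge\varphi_3(\rho,n).$$ -/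

import Mathlib

open Filter Asymptotics

/-- The infinity distance `max_i |f(i) - g(i)|` between two permutations of an `n`-element chain. -/
def infDistPerm {n : ℕ} (f g : Equiv.Perm (Fin n)) : ℕ :=
  Finset.univ.sup fun i : Fin n => (((f i : ℕ) : ℤ) - ((g i : ℕ) : ℤ)).natAbs

/-- The ball of radius `r` centred at the permutation `f`, in the infinity metric on `S_n`. -/
def permBall (n r : ℕ) (f : Equiv.Perm (Fin n)) : Finset (Equiv.Perm (Fin n)) :=
  Finset.univ.filter fun g => infDistPerm f g ≤ r

/-- The Lambert `W` function on the non-negative reals: `lambertW z` is the unique `w ≥ 0` with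
`w * exp w = z` (see `lambertW_eq_iff`). -/
noncomputable def lambertW (z : ℝ) : ℝ :=
  Function.invFunOn (fun w : ℝ => w * Real.exp w) (Set.Ici 0) z

theorem strictMonoOn_mul_exp :
    StrictMonoOn (fun w : ℝ => w * Real.exp w) (Set.Ici 0) := by
  intro a ha b _ hab
  have h1 := Real.exp_lt_exp.2 hab
  have h0 := Real.exp_pos a
  have ha' : (0 : ℝ) ≤ a := ha
  show a * Real.exp a < b * Real.exp b
  nlinarith [mul_le_mul_of_nonneg_left h1.le ha']

theorem lambertW_spec {z : ℝ} (hz : 0 ≤ z) :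
    0 ≤ lambertW z ∧ lambertW z * Real.exp (lambertW z) = z := by
  have hex : ∃ w ∈ Set.Ici (0 : ℝ), (fun w : ℝ => w * Real.exp w) w = z := by
    have hc : ContinuousOn (fun w : ℝ => w * Real.exp w) (Set.Icc 0 z) := by fun_prop
    have hz' : z ∈ Set.Icc ((fun w : ℝ => w * Real.exp w) 0)
        ((fun w : ℝ => w * Real.exp w) z) := by
      refine ⟨by simpa using hz, ?_⟩
      have := Real.one_le_exp hz
      show z ≤ z * Real.exp z
      nlinarith
    obtain ⟨w, hw, hw'⟩ := intermediate_value_Icc hz hc hz'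
    exact ⟨w, hw.1, hw'⟩
  exact ⟨Function.invFunOn_mem hex, Function.invFunOn_eq hex⟩

/-- For `z ≥ 0`, the equation `w * exp w = z` has exactly one real solution, `w = lambertW z`. -/
theorem lambertW_eq_iff {z w : ℝ} (hz : 0 ≤ z) : lambertW z = w ↔ w * Real.exp w = z := by
  obtain ⟨h0, h1⟩ := lambertW_spec hz
  constructor
  · rintro rfl
    exact h1
  · intro h
    have hw : 0 ≤ w := by
      by_contra hneg
      have := mul_neg_of_neg_of_pos (not_le.1 hneg) (Real.exp_pos w)
      linarith
    exact strictMonoOn_mul_exp.injOn h0 hw (h1.trans h.symm)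

/-- The constant `t̂` attached to the normalized radius `ρ`. -/
noncomputable def tHat (ρ : ℝ) : ℝ :=
  Real.logb 2 (Real.exp 1) *
    (2 * (1 - ρ) / (2 * ρ - 1) -
      lambertW ((1 - ρ) * Real.exp (2 * (1 - ρ) / (2 * ρ - 1)) / (2 * ρ - 1)))

/-- `t̂` is positive, so that its logarithm is meaningful. -/
theorem tHat_pos {ρ : ℝ} (h : 1 / 2 < ρ) (h' : ρ < 1) : 0 < tHat ρ := by
  have hd : 0 < 2 * ρ - 1 := by linarith
  have hc : 0 < (1 - ρ) / (2 * ρ - 1) := div_pos (by linarith) hd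
  set c := (1 - ρ) / (2 * ρ - 1) with hcdef
  have e1 : 2 * (1 - ρ) / (2 * ρ - 1) = 2 * c := by rw [hcdef]; ring
  have e2 : (1 - ρ) * Real.exp (2 * c) / (2 * ρ - 1) = c * Real.exp (2 * c) := by
    rw [hcdef]; ring
  have hp : 0 < c * Real.exp (2 * c) := mul_pos hc (Real.exp_pos _)
  obtain ⟨h0, h1⟩ := lambertW_spec hp.le
  unfold tHat
  rw [e1, e2]
  refine mul_pos (Real.logb_pos (by norm_num) (Real.one_lt_exp_iff.2 one_pos)) (sub_pos.2 ?_)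
  refine (strictMonoOn_mul_exp.lt_iff_lt h0 (show (0 : ℝ) ≤ 2 * c by linarith)).1 ?_
  show lambertW _ * Real.exp (lambertW _) < 2 * c * Real.exp (2 * c)
  rw [h1]
  linarith

/-- The explicit part of `log₂ φ₃(ρ, n)`, that is, all of it except the `o(n)` term. -/
noncomputable def logPhi3Main (ρ : ℝ) (n : ℕ) : ℝ :=
  n * Real.logb 2 n -
    n * (Real.logb 2 (Real.exp 1 * tHat ρ / Real.logb 2 (Real.exp 1)) -
      tHat ρ * (2 * ρ - 1) - Real.logb 2 (1 - ρ))

/-!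
The ball of radius `r` is counted by the permanent of the 0-1 matrix supported on the band
`|i - j| ≤ r` (`card_permBall`), and this permanent is bounded below by its capacity.

If `A` is a non-negative `n × n` matrix with `c * ∏ x j ≤ ∏ i, ∑ j, A i j * x j` for all positive
`x`, then `c * e⁻ⁿ ≤ per A` (`capacity_le_permanent`); this is Gurvits' argument. The columns of `A`
are put one at a time into the product of linear forms on the right, each time by differentiating
in the direction of the column. The polynomials that arise have no zeros with all coordinates in the
right half-plane (`mixedPermanent_ne_zero_of_re_pos`), hence only real negative zeros on positive
lines. A univariate polynomial `R` of this kind satisfies `R t ≤ R 0 * exp (t * R' 0 / R 0)`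
(`Polynomial.norm_eval_le_of_roots_neg`), so that each differentiation costs at most a factor `e`.

The capacity of the band matrix is bounded below by scaling the matrix to a doubly stochastic one
(`scaling_le_capacity`). For `s = n - 1 - r` and `q = n - 2 * s` the entries `l ^ (e i + e j)`, where
`e i = min i s (n - 1 - i)`, have equal row sums exactly when `2 * (1 - l ^ s) + q * (1 - l) * l ^ s = 1`
(`sum_bandMatrix_mul_pow`). With `l = exp (-τ / s)` this becomes
`exp τ + q * (1 - exp (-τ / s)) = 2`, and the bound is
`log |B| ≥ -n * log (1 - exp (-τ / s)) + (q - 2) * τ - n` (`exp_le_permanent_bandMatrix`).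

As `n → ∞` the equation for `τ` tends to `exp t + (2 * ρ - 1) / (1 - ρ) * t = 2`, whose solution is
`t = tHat ρ * log 2` by the defining property of the Lambert function (`exists_tHat_eq`). The two
roots differ by `O(1 / n)` (`abs_sub_root_le`), so the error term in the exponent is even bounded.
-/

/-! ### Mixed permanents and polynomials with negative roots -/

section MixedPermanent

variable {ι : Type*} [Fintype ι] [DecidableEq ι]

/-- The permanent of the matrix obtained from `A` by replacing every column outside `J` with the
vector `w`. Up to a constant factor, it is the iterated derivative of `w ↦ ∏ i, w i` in the
directions of the columns of `A` indexed by `J`. -/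
def mixedPermanent {R : Type*} [CommSemiring R] (A : Matrix ι ι R) (J : Finset ι) (w : ι → R) : R :=
  Matrix.permanent (Matrix.of fun i j => if j ∈ J then A i j else w i)

theorem mixedPermanent_eq_sum {R : Type*} [CommSemiring R] (A : Matrix ι ι R) (J : Finset ι)
    (w : ι → R) :
    mixedPermanent A J w = ∑ σ : Equiv.Perm ι, ∏ j, if j ∈ J then A (σ j) j else w (σ j) := rfl

theorem mixedPermanent_empty {R : Type*} [CommSemiring R] (A : Matrix ι ι R) (w : ι → R) :
    mixedPermanent A ∅ w = (Fintype.card ι).factorial * ∏ i, w i := by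
  have (σ : Equiv.Perm ι) : ∏ i, w (σ i) = ∏ i, w i := Equiv.prod_comp σ w
  simp [mixedPermanent_eq_sum, this, Fintype.card_perm]

theorem mixedPermanent_smul {R : Type*} [CommSemiring R] (A : Matrix ι ι R) (J : Finset ι)
    (c : R) (w : ι → R) :
    mixedPermanent A J (fun i => c * w i) = c ^ Jᶜ.card * mixedPermanent A J w := by
  have hc : c ^ Jᶜ.card = ∏ j, if j ∈ J then 1 else c := by
    rw [← Finset.prod_const, ← Finset.prod_subset (Finset.subset_univ Jᶜ)]
    · exact Finset.prod_congr rfl fun j hj => by simp [Finset.mem_compl.1 hj]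
    · intro j _ hj
      simp [by simpa using hj]
  rw [hc, mixedPermanent_eq_sum, mixedPermanent_eq_sum, Finset.mul_sum]
  refine Finset.sum_congr rfl fun σ _ => ?_
  rw [← Finset.prod_mul_distrib]
  exact Finset.prod_congr rfl fun j _ => by split_ifs <;> simp

/-- Replacing the column `k`, rather than `j₀`, with the `j₀`-th column of `A` makes no difference:
both columns would otherwise be equal to `w`. -/
theorem permanent_replace_column {R : Type*} [CommSemiring R] (A : Matrix ι ι R) {J : Finset ι}
    (w : ι → R) {j₀ k : ι} (hj₀ : j₀ ∉ J) (hk : k ∉ J) :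
    Matrix.permanent (Matrix.of fun i j => if j ∈ J then A i j else if j = k then A i j₀ else w i) =
      mixedPermanent A (insert j₀ J) w := by
  rw [← Matrix.permanent_permute_rows (Equiv.swap k j₀), mixedPermanent]
  congr 1
  ext i j
  simp only [Matrix.submatrix_apply, Matrix.of_apply, id, Finset.mem_insert]
  by_cases h1 : j = j₀
  · subst h1
    simp [hk]
  by_cases h2 : j = k
  · subst h2
    simp [hj₀, hk, h1, Ne.symm h1]
  · simp [Equiv.swap_apply_of_ne_of_ne h2 h1, h1, h2]

theorem mixedPermanent_ofReal (A : Matrix ι ι ℝ) (J : Finset ι) (w : ι → ℝ) :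
    mixedPermanent (A.map Complex.ofReal) J (fun i => (w i : ℂ)) = (mixedPermanent A J w : ℝ) := by
  simp only [mixedPermanent_eq_sum, Complex.ofReal_sum, Complex.ofReal_prod]
  refine Finset.sum_congr rfl fun σ _ => Finset.prod_congr rfl fun j _ => ?_
  split_ifs <;> simp

theorem mixedPermanent_pos {A : Matrix ι ι ℝ} (hA : ∀ i j, 0 < A i j) (J : Finset ι) {w : ι → ℝ}
    (hw : ∀ i, 0 < w i) : 0 < mixedPermanent A J w := by
  rw [mixedPermanent_eq_sum]
  refine Finset.sum_pos (fun σ _ => Finset.prod_pos fun j _ => ?_) Finset.univ_nonempty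
  split_ifs
  exacts [hA _ _, hw _]

open Polynomial in
/-- The restriction of `mixedPermanent A J` to the line through `w` in the direction `a`. -/
noncomputable def linePoly {R : Type*} [CommSemiring R] (A : Matrix ι ι R) (J : Finset ι)
    (w a : ι → R) : Polynomial R :=
  ∑ σ : Equiv.Perm ι, ∏ j, if j ∈ J then C (A (σ j) j) else C (w (σ j)) + X * C (a (σ j))

theorem linePoly_eval {R : Type*} [CommSemiring R] (A : Matrix ι ι R) (J : Finset ι)
    (w a : ι → R) (t : R) :
    (linePoly A J w a).eval t = mixedPermanent A J (fun i => w i + t * a i) := by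
  simp only [linePoly, mixedPermanent_eq_sum, Polynomial.eval_finsetSum, Polynomial.eval_prod]
  refine Finset.sum_congr rfl fun σ _ => Finset.prod_congr rfl fun j _ => ?_
  split_ifs
  · simp
  · simp [mul_comm t]

theorem linePoly_derivative_eval_zero {R : Type*} [CommSemiring R] (A : Matrix ι ι R) {J : Finset ι}
    (w : ι → R) {j₀ : ι} (hj₀ : j₀ ∉ J) :
    (Polynomial.derivative (linePoly A J w fun i => A i j₀)).eval 0 =
      Jᶜ.card * mixedPermanent A (insert j₀ J) w := by
  have hR : (Jᶜ.card : R) * mixedPermanent A (insert j₀ J) w =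
      ∑ k, if k ∈ J then 0 else Matrix.permanent
        (Matrix.of fun i j => if j ∈ J then A i j else if j = k then A i j₀ else w i) := by
    rw [← nsmul_eq_mul, ← Finset.sum_const, ← Finset.sum_subset (Finset.subset_univ Jᶜ)]
    · refine Finset.sum_congr rfl fun k hk => ?_
      have hk := Finset.mem_compl.1 hk
      rw [if_neg hk, permanent_replace_column A w hj₀ hk]
    · intro j _ hj
      simp [by simpa using hj]
  rw [hR, linePoly, Polynomial.derivative_sum, Polynomial.eval_finsetSum]
  simp only [Polynomial.derivative_prod_finset, Polynomial.eval_finsetSum]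
  rw [Finset.sum_comm]
  refine Finset.sum_congr rfl fun k _ => ?_
  by_cases hk : k ∈ J
  · simp [hk]
  · rw [if_neg hk, Matrix.permanent]
    refine Finset.sum_congr rfl fun σ _ => ?_
    rw [← Finset.prod_erase_mul _ _ (Finset.mem_univ k), Polynomial.eval_mul, Polynomial.eval_prod]
    congr 1
    · refine Finset.prod_congr rfl fun j hj => ?_
      have := Finset.ne_of_mem_erase hj
      simp only [Matrix.of_apply]
      split_ifs <;> simp
    · simp [hk]

end MixedPermanent

/-- A polynomial whose roots are all real and negative grows on the positive half-line at most as
fast as the exponential function with the same value and the same slope at `0`. -/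
theorem Polynomial.norm_eval_le_of_roots_neg {G : Polynomial ℂ}
    (hG : ∀ z, G.eval z = 0 → z.im = 0 ∧ z.re < 0) {t : ℝ} (ht : 0 ≤ t) :
    ‖G.eval (t : ℂ)‖ ≤ ‖G.eval 0‖ * Real.exp (t * (G.derivative.eval 0 / G.eval 0).re) := by
  have h0 : G.eval 0 ≠ 0 := fun h => by simpa using (hG 0 h).2
  have hne : G ≠ 0 := by rintro rfl; simp at h0
  have hroot : ∀ z ∈ G.roots, z.im = 0 ∧ z.re < 0 := fun z hz =>
    hG z ((Polynomial.mem_roots hne).1 hz)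
  rw [(IsAlgClosed.splits G).eval_derivative_div_eval_of_ne_zero h0,
    (IsAlgClosed.splits G).eval_eq_prod_roots, (IsAlgClosed.splits G).eval_eq_prod_roots,
    norm_mul, norm_mul, mul_assoc]
  refine mul_le_mul_of_nonneg_left ?_ (norm_nonneg _)
  generalize G.roots = s at hroot
  induction s using Multiset.induction_on with
  | empty => simp
  | cons z s ih =>
    obtain ⟨him, hre⟩ := hroot z (Multiset.mem_cons_self z s)
    have ih := ih fun z hz => hroot z (Multiset.mem_cons_of_mem hz)
    simp only [Multiset.map_cons, Multiset.prod_cons, Multiset.sum_cons, norm_mul, Complex.add_re,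
      mul_add, Real.exp_add]
    obtain ⟨x, rfl⟩ : ∃ x : ℝ, z = ((-x : ℝ) : ℂ) := ⟨-z.re, by
      apply Complex.ext <;> simp [him]⟩
    have hx : 0 < x := by simpa using hre
    have e1 : ‖(t : ℂ) - ((-x : ℝ) : ℂ)‖ = t + x := by
      rw [← Complex.ofReal_sub, Complex.norm_real, Real.norm_eq_abs, sub_neg_eq_add,
        abs_of_pos (by linarith)]
    have e2 : ‖(0 : ℂ) - ((-x : ℝ) : ℂ)‖ = x := by
      rw [← Complex.ofReal_zero, ← Complex.ofReal_sub, Complex.norm_real, Real.norm_eq_abs,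
        sub_neg_eq_add, zero_add, abs_of_pos hx]
    have e3 : (1 / ((0 : ℂ) - ((-x : ℝ) : ℂ))).re = x⁻¹ := by
      rw [← Complex.ofReal_zero, ← Complex.ofReal_sub, ← Complex.ofReal_one, ← Complex.ofReal_div,
        Complex.ofReal_re]
      simp
    rw [e1, e2, e3]
    have h1 : t + x ≤ x * Real.exp (t * x⁻¹) := by
      have := Real.add_one_le_exp (t * x⁻¹)
      calc t + x = x * (t * x⁻¹ + 1) := by field_simp
        _ ≤ _ := mul_le_mul_of_nonneg_left this hx.le
    calc _ ≤ (x * Real.exp (t * x⁻¹)) * _ :=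
          mul_le_mul h1 ih (norm_nonneg _) (by positivity)
      _ = _ := by ring

/-! ### Stability, and the capacity bound for the permanent -/

section Capacity

variable {ι : Type*} [Fintype ι] [DecidableEq ι]

/-- For a positive matrix, `mixedPermanent A J` has no zeros with all coordinates in the right
half-plane. Going from `J` to `insert j₀ J` means differentiating in a positive direction; the
roots on the corresponding line lie in the open left half-plane, hence so does no value of the
logarithmic derivative. -/
theorem mixedPermanent_ne_zero_of_re_pos {A : Matrix ι ι ℝ} (hA : ∀ i j, 0 < A i j) (J : Finset ι) :
    ∀ w : ι → ℂ, (∀ i, 0 < (w i).re) → mixedPermanent (A.map Complex.ofReal) J w ≠ 0 := by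
  induction J using Finset.induction_on with
  | empty =>
    intro w hw
    rw [mixedPermanent_empty]
    refine mul_ne_zero (by exact_mod_cast (Nat.factorial_pos _).ne') ?_
    refine Finset.prod_ne_zero_iff.2 fun i _ h => ?_
    simpa [h] using hw i
  | insert j₀ J hj₀ ih =>
    intro w hw
    set a : ι → ℂ := fun i => (A i j₀ : ℂ) with ha
    set G := linePoly (A.map Complex.ofReal) J w a with hGdef
    have hcard : 0 < Jᶜ.card := Finset.card_pos.2 ⟨j₀, by simpa using hj₀⟩
    have hG0 : G.eval 0 ≠ 0 := by
      rw [hGdef, linePoly_eval]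
      simpa using ih w hw
    have hG' : G.derivative.eval 0 =
        Jᶜ.card * mixedPermanent (A.map Complex.ofReal) (insert j₀ J) w :=
      linePoly_derivative_eval_zero (A.map Complex.ofReal) w hj₀
    have hne : G ≠ 0 := by intro h; simp [h] at hG0
    have hroot : ∀ z ∈ G.roots, z.re < 0 := by
      intro z hz
      by_contra hre
      have hz0 : G.eval z = 0 := (Polynomial.mem_roots hne).1 hz
      rw [hGdef, linePoly_eval] at hz0
      refine ih _ (fun i => ?_) hz0
      have := mul_nonneg (not_lt.1 hre) (hA i j₀).le
      simp only [ha, Complex.add_re, Complex.mul_re, Complex.ofReal_re, Complex.ofReal_im]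
      linarith [hw i]
    -- Otherwise `mixedPermanent A J` would vanish at the positive vector `a`.
    have hroots : G.roots ≠ 0 := by
      intro h
      have hconst (t : ℂ) : G.eval t = G.eval 0 := by
        rw [(IsAlgClosed.splits G).eval_eq_prod_roots, (IsAlgClosed.splits G).eval_eq_prod_roots, h]
        simp
      have heq (s : ℂ) (hs : s ≠ 0) :
          mixedPermanent (A.map Complex.ofReal) J (fun i => s * w i + a i) =
            s ^ Jᶜ.card * G.eval 0 := by
        rw [← hconst s⁻¹, hGdef, linePoly_eval, ← mixedPermanent_smul]
        congr 1
        ext i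
        field_simp
      have hcont : Continuous fun s : ℂ =>
          mixedPermanent (A.map Complex.ofReal) J (fun i => s * w i + a i) -
            s ^ Jᶜ.card * G.eval 0 := by
        simp only [mixedPermanent_eq_sum]
        refine Continuous.sub (continuous_finsetSum _ fun σ _ => continuous_finsetProd _
          fun j _ => ?_) (by fun_prop)
        split_ifs <;> fun_prop
      have hzero : (fun s : ℂ =>
          mixedPermanent (A.map Complex.ofReal) J (fun i => s * w i + a i) -
            s ^ Jᶜ.card * G.eval 0) = fun _ => 0 := by
        refine Continuous.ext_on (dense_compl_singleton (0 : ℂ)) hcont continuous_const ?_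
        intro s hs
        simp [heq s (by simpa using hs)]
      have := congrFun hzero 0
      simp only [zero_mul, zero_add, zero_pow hcard.ne', sub_zero] at this
      exact ih a (fun i => by simpa [ha] using hA i j₀) this
    have hsum : 0 < (G.derivative.eval 0 / G.eval 0).re := by
      rw [(IsAlgClosed.splits G).eval_derivative_div_eval_of_ne_zero hG0]
      generalize G.roots = s at hroot hroots
      induction s using Multiset.induction_on with
      | empty => exact absurd rfl hroots
      | cons z s ihs =>
        have hz : 0 < (1 / (0 - z)).re := by
          have hz := hroot z (Multiset.mem_cons_self z s)
          have hz0 : z ≠ 0 := by rintro rfl; simp at hz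
          rw [zero_sub, one_div, Complex.inv_re]
          refine div_pos (by simpa using hz) (Complex.normSq_pos.2 (neg_ne_zero.2 hz0))
        rw [Multiset.map_cons, Multiset.sum_cons, Complex.add_re]
        rcases eq_or_ne s 0 with rfl | hs
        · simpa using hz
        · exact add_pos hz (ihs (fun y hy => hroot y (Multiset.mem_cons_of_mem hy)) hs)
    intro h
    rw [hG', h] at hsum
    simp at hsum

/-- On a positive line `mixedPermanent A J` grows at most exponentially: all its roots there are
real and negative. -/
theorem mixedPermanent_line_le {A : Matrix ι ι ℝ} (hA : ∀ i j, 0 < A i j) {J : Finset ι}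
    {j₀ : ι} (hj₀ : j₀ ∉ J) {u : ι → ℝ} (hu : ∀ i, 0 < u i) {t : ℝ} (ht : 0 ≤ t) :
    mixedPermanent A J (fun i => u i + t * A i j₀) ≤ mixedPermanent A J u *
      Real.exp (t * (Jᶜ.card * mixedPermanent A (insert j₀ J) u / mixedPermanent A J u)) := by
  set w : ι → ℂ := fun i => (u i : ℂ) with hw
  set a : ι → ℂ := fun i => (A i j₀ : ℂ) with ha
  set G := linePoly (A.map Complex.ofReal) J w a with hGdef
  have heval (t : ℝ) : G.eval (t : ℂ) = (mixedPermanent A J (fun i => u i + t * A i j₀) : ℝ) := by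
    rw [hGdef, linePoly_eval, ← mixedPermanent_ofReal]
    simp [hw, ha]
  have heval0 : G.eval 0 = (mixedPermanent A J u : ℝ) := by
    have := heval 0
    simpa using this
  have hder : G.derivative.eval 0 = (Jᶜ.card * mixedPermanent A (insert j₀ J) u : ℝ) := by
    rw [Complex.ofReal_mul, ← mixedPermanent_ofReal]
    exact linePoly_derivative_eval_zero (A.map Complex.ofReal) w hj₀
  have hG : ∀ z, G.eval z = 0 → z.im = 0 ∧ z.re < 0 := by
    intro z hz
    rw [hGdef, linePoly_eval] at hz
    -- Rotating the values `u i + z * A i j₀` by a right angle moves them to the right half-plane.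
    have rot (c : ℂ) (hc : ∀ i, 0 < (c * (w i + z * a i)).re) : False :=
      mixedPermanent_ne_zero_of_re_pos hA J _ hc (by rw [mixedPermanent_smul, hz, mul_zero])
    have him : z.im = 0 := by
      rcases lt_trichotomy z.im 0 with h | h | h
      · refine (rot Complex.I fun i => ?_).elim
        have := mul_pos (neg_pos.2 h) (hA i j₀)
        simpa [hw, ha] using this
      · exact h
      · refine (rot (-Complex.I) fun i => ?_).elim
        have := mul_pos h (hA i j₀)
        simpa [hw, ha] using this
    refine ⟨him, ?_⟩
    by_contra hre
    refine rot 1 fun i => ?_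
    have := mul_nonneg (not_lt.1 hre) (hA i j₀).le
    simp only [hw, ha, one_mul, Complex.add_re, Complex.mul_re, Complex.ofReal_re,
      Complex.ofReal_im]
    linarith [hu i]
  have key := Polynomial.norm_eval_le_of_roots_neg hG ht
  rw [heval, heval0, hder, ← Complex.ofReal_div, Complex.ofReal_re, Complex.norm_real,
    Complex.norm_real, Real.norm_of_nonneg (mixedPermanent_pos hA J hu).le,
    Real.norm_of_nonneg (mixedPermanent_pos hA J fun i => ?_).le] at key
  · exact key
  · have := mul_nonneg ht (hA i j₀).le
    linarith [hu i]

/-- Each column `j₀` put into the permanent costs a factor `e` only. -/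
theorem capacity_le_mixedPermanent {A : Matrix ι ι ℝ} (hA : ∀ i j, 0 < A i j) {c : ℝ}
    (hcap : ∀ x : ι → ℝ, (∀ j, 0 < x j) → c * ∏ j, x j ≤ ∏ i, ∑ j, A i j * x j)
    (J : Finset ι) (hJ : J ≠ Finset.univ) (y : ι → ℝ) (hy : ∀ j, 0 < y j) :
    c * Jᶜ.card.factorial * Real.exp (-J.card) * ∏ j ∈ Jᶜ, y j ≤
      mixedPermanent A J (fun i => ∑ j ∈ Jᶜ, A i j * y j) := by
  induction J using Finset.induction_on generalizing y with
  | empty =>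
    rw [mixedPermanent_empty]
    have := mul_le_mul_of_nonneg_left (hcap y hy) (Nat.cast_nonneg (α := ℝ) (Fintype.card ι).factorial)
    simp only [Finset.compl_empty, Finset.card_univ, Finset.card_empty, Nat.cast_zero, neg_zero,
      Real.exp_zero]
    linarith
  | insert j₀ J hj₀ ih =>
    have hJ' : J ≠ Finset.univ := fun h => hj₀ (h ▸ Finset.mem_univ _)
    have hj₀' : j₀ ∈ Jᶜ := Finset.mem_compl.2 hj₀
    have hcompl : (insert j₀ J)ᶜ = Jᶜ.erase j₀ := Finset.compl_insert
    set u : ι → ℝ := fun i => ∑ j ∈ (insert j₀ J)ᶜ, A i j * y j with hu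
    have hne : ((insert j₀ J)ᶜ).Nonempty := by
      rwa [Finset.nonempty_iff_ne_empty, Ne, Finset.compl_eq_empty_iff]
    have hupos (i : ι) : 0 < u i := Finset.sum_pos (fun j _ => mul_pos (hA i j) (hy j)) hne
    set R₀ := mixedPermanent A J u with hR₀
    set R₁ := mixedPermanent A (insert j₀ J) u with hR₁
    have h0 : 0 < R₀ := mixedPermanent_pos hA J hupos
    have h1 : 0 < R₁ := mixedPermanent_pos hA _ hupos
    have hcard : Jᶜ.card = (insert j₀ J)ᶜ.card + 1 := by
      rw [hcompl, Finset.card_erase_add_one hj₀']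
    have hk : (0 : ℝ) < Jᶜ.card := by rw [hcard]; positivity
    -- At this point of the line the exponential bound is `e` times the value at the origin.
    set t := R₀ / (Jᶜ.card * R₁) with ht
    have htpos : 0 < t := by positivity
    have key := ih hJ' (Function.update y j₀ t) (fun j => by
      rcases eq_or_ne j j₀ with rfl | h
      · simpa using htpos
      · simpa [h] using hy j)
    have hupd : ∀ j ∈ Jᶜ.erase j₀, Function.update y j₀ t j = y j := fun j hj =>
      Function.update_of_ne (Finset.ne_of_mem_erase hj) _ _
    have e1 : (fun i => ∑ j ∈ Jᶜ, A i j * Function.update y j₀ t j) =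
        fun i => u i + t * A i j₀ := by
      ext i
      rw [← Finset.sum_erase_add _ _ hj₀', hu, hcompl, Function.update_self, mul_comm t]
      congr 1
      exact Finset.sum_congr rfl fun j hj => by rw [hupd j hj]
    have e2 : ∏ j ∈ Jᶜ, Function.update y j₀ t j = (∏ j ∈ (insert j₀ J)ᶜ, y j) * t := by
      rw [← Finset.prod_erase_mul _ _ hj₀', hcompl, Function.update_self]
      congr 1
      exact Finset.prod_congr rfl hupd
    rw [e1, e2] at key
    have hline := key.trans (mixedPermanent_line_le hA hj₀ hupos htpos.le)
    rw [← hR₀, ← hR₁, show t * (Jᶜ.card * R₁ / R₀) = 1 by rw [ht]; field_simp] at hline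
    rw [Finset.card_insert_of_notMem hj₀, Nat.cast_add_one, neg_add, Real.exp_add]
    rw [hcard, Nat.factorial_succ, Nat.cast_mul, ← hcard] at hline
    set P := ∏ j ∈ (insert j₀ J)ᶜ, y j
    set F : ℝ := ((insert j₀ J)ᶜ.card.factorial : ℝ)
    have hE : Real.exp 1 * Real.exp (-1) = 1 := by rw [← Real.exp_add]; simp
    have htR : Jᶜ.card * t * R₁ = R₀ := by rw [ht]; field_simp
    have hkt : 0 < Jᶜ.card * t := by positivity
    refine le_of_mul_le_mul_left ?_ hkt
    calc Jᶜ.card * t * (c * F * (Real.exp (-J.card) * Real.exp (-1)) * P)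
        = c * (Jᶜ.card * F) * Real.exp (-J.card) * (P * t) * Real.exp (-1) := by ring
      _ ≤ R₀ * Real.exp 1 * Real.exp (-1) :=
          mul_le_mul_of_nonneg_right hline (Real.exp_pos _).le
      _ = R₀ := by rw [mul_assoc, hE, mul_one]
      _ = _ := htR.symm

theorem capacity_le_permanent_of_pos {A : Matrix ι ι ℝ} (hA : ∀ i j, 0 < A i j) {c : ℝ} (hc : 0 < c)
    (hcap : ∀ x : ι → ℝ, (∀ j, 0 < x j) → c * ∏ j, x j ≤ ∏ i, ∑ j, A i j * x j) [Nonempty ι] :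
    c * Real.exp (-Fintype.card ι) ≤ A.permanent := by
  obtain ⟨j₀⟩ := ‹Nonempty ι›
  have h := capacity_le_mixedPermanent hA hcap (Finset.univ.erase j₀)
    (Finset.erase_ne_self.2 (Finset.mem_univ j₀)) (fun _ => 1)
    fun _ => one_pos
  have e0 : (Finset.univ.erase j₀)ᶜ = {j₀} := by simp [Finset.compl_erase]
  have e1 : mixedPermanent A (Finset.univ.erase j₀) (fun i => ∑ j ∈ {j₀}, A i j * 1) =
      A.permanent := by
    rw [mixedPermanent]
    congr 1
    ext i j
    by_cases h : j = j₀ <;> simp [h]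
  rw [e0, e1] at h
  simp only [Finset.card_singleton, Nat.factorial_one, Nat.cast_one, Finset.prod_const_one,
    mul_one] at h
  refine le_trans (mul_le_mul_of_nonneg_left (Real.exp_le_exp.2 (neg_le_neg ?_)) hc.le) h
  exact_mod_cast Finset.card_le_univ _

/-- A lower bound for the permanent in the manner of Gurvits: a matrix with non-negative entries
and capacity at least `c` has permanent at least `c * e⁻ⁿ`. -/
theorem capacity_le_permanent [Nonempty ι] {A : Matrix ι ι ℝ} (hA : ∀ i j, 0 ≤ A i j) {c : ℝ}
    (hc : 0 < c)
    (hcap : ∀ x : ι → ℝ, (∀ j, 0 < x j) → c * ∏ j, x j ≤ ∏ i, ∑ j, A i j * x j) :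
    c * Real.exp (-Fintype.card ι) ≤ A.permanent := by
  have hcont : Continuous fun ε : ℝ => (Matrix.of fun i j => A i j + ε).permanent := by
    simp only [Matrix.permanent, Matrix.of_apply]
    fun_prop
  have hlim := (hcont.tendsto 0).mono_left (nhdsWithin_le_nhds (s := Set.Ioi 0))
  simp only [add_zero] at hlim
  refine ge_of_tendsto hlim ?_
  filter_upwards [self_mem_nhdsWithin] with ε (hε : 0 < ε)
  refine capacity_le_permanent_of_pos (fun i j => add_pos_of_nonneg_of_pos (hA i j) hε) hc
    fun x hx => (hcap x hx).trans ?_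
  refine Finset.prod_le_prod (fun i _ => Finset.sum_nonneg fun j _ =>
    mul_nonneg (hA i j) (hx j).le) fun i _ => Finset.sum_le_sum fun j _ => ?_
  exact mul_le_mul_of_nonneg_right (by simp [hε.le]) (hx j).le

end Capacity

/-! ### Doubly stochastic scaling of the band matrix -/

section Scaling

variable {ι : Type*} [Fintype ι]

/-- If `g i * A i j * h j` is doubly stochastic, then the capacity of `A` is at least
`∏ i, (g i * h i)⁻¹`, by the weighted inequality of arithmetic and geometric means in each row. -/
theorem scaling_le_capacity {A : Matrix ι ι ℝ} (hA : ∀ i j, 0 ≤ A i j) {g h : ι → ℝ}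
    (hg : ∀ i, 0 < g i) (hh : ∀ j, 0 < h j) (hrow : ∀ i, ∑ j, g i * A i j * h j = 1)
    (hcol : ∀ j, ∑ i, g i * A i j * h j = 1) {x : ι → ℝ} (hx : ∀ j, 0 < x j) :
    (∏ i, (g i * h i)⁻¹) * ∏ j, x j ≤ ∏ i, ∑ j, A i j * x j := by
  have hxh (j : ι) : 0 < x j / h j := div_pos (hx j) (hh j)
  have hrow' (i : ι) :
      (g i)⁻¹ * ∏ j, (x j / h j) ^ (g i * A i j * h j) ≤ ∑ j, A i j * x j := by
    have hamgm := Real.geom_mean_le_arith_mean_weighted Finset.univ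
      (fun j => g i * A i j * h j) (fun j => x j / h j)
      (fun j _ => mul_nonneg (mul_nonneg (hg i).le (hA i j)) (hh j).le) (hrow i)
      (fun j _ => (hxh j).le)
    calc _ ≤ (g i)⁻¹ * ∑ j, g i * A i j * h j * (x j / h j) :=
          mul_le_mul_of_nonneg_left hamgm (inv_pos.2 (hg i)).le
      _ = _ := by
          rw [Finset.mul_sum]
          refine Finset.sum_congr rfl fun j _ => ?_
          have := (hg i).ne'
          have := (hh j).ne'
          field_simp
  have hprod : ∏ i, ∏ j, (x j / h j) ^ (g i * A i j * h j) = ∏ j, x j / h j := by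
    rw [Finset.prod_comm]
    refine Finset.prod_congr rfl fun j _ => ?_
    rw [← Real.rpow_sum_of_pos (hxh j), hcol j, Real.rpow_one]
  calc (∏ i, (g i * h i)⁻¹) * ∏ j, x j
      = ∏ i, ((g i)⁻¹ * ∏ j, (x j / h j) ^ (g i * A i j * h j)) := by
        rw [Finset.prod_mul_distrib, hprod, ← Finset.prod_mul_distrib, ← Finset.prod_mul_distrib]
        refine Finset.prod_congr rfl fun i _ => ?_
        rw [mul_inv, div_eq_mul_inv]
        ring
    _ ≤ _ := Finset.prod_le_prod (fun i _ => mul_nonneg (inv_pos.2 (hg i)).le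
        (Finset.prod_nonneg fun j _ => (Real.rpow_pos_of_pos (hxh j) _).le)) fun i _ => hrow' i

end Scaling

section Band

/-- The 0-1 matrix of size `n` supported on the band of width `r` around the diagonal. -/
def bandMatrix (n r : ℕ) : Matrix (Fin n) (Fin n) ℝ :=
  Matrix.of fun i j => if (i : ℕ) ≤ j + r ∧ (j : ℕ) ≤ i + r then 1 else 0

theorem card_permBall (n r : ℕ) (f : Equiv.Perm (Fin n)) :
    ((permBall n r f).card : ℝ) = (bandMatrix n r).permanent := by
  rw [Matrix.permanent, permBall, Finset.card_filter, Nat.cast_sum]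
  refine Fintype.sum_equiv (Equiv.mulRight f⁻¹) _ _ fun g => ?_
  rw [← Equiv.prod_comp f]
  have hinv (i : Fin n) : f⁻¹ (f i) = i := f.symm_apply_apply i
  simp only [bandMatrix, Matrix.of_apply, Equiv.coe_mulRight, Equiv.Perm.mul_apply, hinv]
  have hiff : infDistPerm f g ≤ r ↔ ∀ i, (g i : ℕ) ≤ f i + r ∧ (f i : ℕ) ≤ g i + r := by
    rw [infDistPerm, Finset.sup_le_iff]
    exact ⟨fun h i => by have := h i (Finset.mem_univ i); omega,
      fun h i _ => by have := h i; omega⟩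
  by_cases h : infDistPerm f g ≤ r
  · have h' := hiff.1 h
    rw [if_pos h, Finset.prod_congr rfl fun i _ => if_pos (h' i)]
    simp
  · have h' := mt hiff.2 h
    push Not at h'
    obtain ⟨i, hi⟩ := h'
    rw [if_neg h, Finset.prod_eq_zero (Finset.mem_univ i)]
    · simp
    · rw [if_neg]
      rintro ⟨h1, h2⟩
      have := hi h1
      omega

/-- The distance of `i` from the ends of the chain `0, …, n - 1`, cut off at `s`. -/
def endDist (n s i : ℕ) : ℕ := min i (min s (n - 1 - i))

theorem sum_endDist (s q : ℕ) :
    ∑ i ∈ Finset.range (s + q + s), endDist (s + q + s) s i + s = s * s + q * s := by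
  have h1 : ∀ x ∈ Finset.range s, endDist (s + q + s) s x = x := fun x hx => by
    have := Finset.mem_range.1 hx
    unfold endDist; omega
  have h2 : ∀ x ∈ Finset.range q, endDist (s + q + s) s (s + x) = s := fun x hx => by
    have := Finset.mem_range.1 hx
    unfold endDist; omega
  have h3 : ∀ x ∈ Finset.range s, endDist (s + q + s) s (s + q + x) = s - 1 - x := fun x hx => by
    have := Finset.mem_range.1 hx
    unfold endDist; omega
  rw [Finset.sum_range_add, Finset.sum_range_add, Finset.sum_congr rfl h1,
    Finset.sum_congr rfl h2, Finset.sum_congr rfl h3,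
    Finset.sum_range_reflect (fun x => x) s, Finset.sum_const, Finset.card_range, smul_eq_mul]
  have := Finset.sum_range_id_mul_two s
  rcases s with _ | s
  · simp
  · simp only [Nat.add_sub_cancel] at this
    nlinarith

theorem sum_pow_endDist (s q : ℕ) (l : ℝ) :
    (∑ i ∈ Finset.range (s + q + s), l ^ endDist (s + q + s) s i) * (1 - l) =
      2 * (1 - l ^ s) + q * (1 - l) * l ^ s := by
  have h1 : ∀ x ∈ Finset.range s, l ^ endDist (s + q + s) s x = l ^ x := fun x hx => by
    have := Finset.mem_range.1 hx
    congr 1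
    unfold endDist; omega
  have h2 : ∀ x ∈ Finset.range q, l ^ endDist (s + q + s) s (s + x) = l ^ s := fun x hx => by
    have := Finset.mem_range.1 hx
    congr 1
    unfold endDist; omega
  have h3 : ∀ x ∈ Finset.range s, l ^ endDist (s + q + s) s (s + q + x) = l ^ (s - 1 - x) :=
    fun x hx => by
      have := Finset.mem_range.1 hx
      congr 1
      unfold endDist; omega
  rw [Finset.sum_range_add, Finset.sum_range_add, Finset.sum_congr rfl h1,
    Finset.sum_congr rfl h2, Finset.sum_congr rfl h3,
    Finset.sum_range_reflect (fun x => l ^ x) s, Finset.sum_const, Finset.card_range,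
    nsmul_eq_mul]
  have := geom_sum_mul_neg l s
  linear_combination 2 * this

/-- The sum of `l ^ endDist j` over the columns `j` that the band excludes from row `i`: these are
the outermost `s - endDist i` columns on one side. -/
theorem sum_pow_endDist_excluded {s q r i : ℕ} (hr : r + 1 = s + q) (hi : i < s + q + s) (l : ℝ) :
    (∑ j ∈ (Finset.range (s + q + s)).filter (fun j => ¬ (i ≤ j + r ∧ j ≤ i + r)),
      l ^ endDist (s + q + s) s j) * (1 - l) = 1 - l ^ (s - endDist (s + q + s) s i) := by
  rcases lt_or_ge i s with h | h
  · have hf : (Finset.range (s + q + s)).filter (fun j => ¬ (i ≤ j + r ∧ j ≤ i + r)) =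
        Finset.Ico (i + r + 1) (s + q + s) := by
      ext j
      simp only [Finset.mem_filter, Finset.mem_range, Finset.mem_Ico]
      omega
    have hk : s + q + s - (i + r + 1) = s - i := by omega
    have he : endDist (s + q + s) s i = i := by unfold endDist; omega
    rw [hf, Finset.sum_Ico_eq_sum_range, hk, he, ← geom_sum_mul_neg,
      ← Finset.sum_range_reflect (fun x => l ^ x) (s - i)]
    congr 1
    refine Finset.sum_congr rfl fun x hx => ?_
    have := Finset.mem_range.1 hx
    congr 1
    unfold endDist; omega
  · rcases lt_or_ge i (s + q) with h' | h'
    · have hf : (Finset.range (s + q + s)).filter (fun j => ¬ (i ≤ j + r ∧ j ≤ i + r)) = ∅ := by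
        ext j
        simp only [Finset.mem_filter, Finset.mem_range, Finset.notMem_empty, iff_false]
        omega
      have he : endDist (s + q + s) s i = s := by unfold endDist; omega
      rw [hf, he]
      simp
    · have hf : (Finset.range (s + q + s)).filter (fun j => ¬ (i ≤ j + r ∧ j ≤ i + r)) =
          Finset.range (i - r) := by
        ext j
        simp only [Finset.mem_filter, Finset.mem_range]
        omega
      have he : s - endDist (s + q + s) s i = i - r := by unfold endDist; omega
      rw [hf, he, ← geom_sum_mul_neg]
      congr 1
      refine Finset.sum_congr rfl fun x hx => ?_
      have := Finset.mem_range.1 hx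
      congr 1
      unfold endDist; omega

/-- The weights `l ^ endDist i` make the band matrix doubly stochastic, up to a constant, as soon as
`l` solves the equation saying that their total is `(1 - l)⁻¹`. -/
theorem sum_bandMatrix_mul_pow {s q r : ℕ} (hr : r + 1 = s + q) {l : ℝ}
    (hl : 2 * (1 - l ^ s) + q * (1 - l) * l ^ s = 1) (i : Fin (s + q + s)) :
    (∑ j, bandMatrix (s + q + s) r i j * l ^ endDist (s + q + s) s j) * (1 - l) =
      l ^ (s - endDist (s + q + s) s i) := by
  have h1 : ∑ j, bandMatrix (s + q + s) r i j * l ^ endDist (s + q + s) s j =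
      ∑ j ∈ (Finset.range (s + q + s)).filter (fun j => (i : ℕ) ≤ j + r ∧ j ≤ i + r),
        l ^ endDist (s + q + s) s j := by
    rw [Finset.sum_filter, Finset.sum_range]
    exact Finset.sum_congr rfl fun j _ => by simp [bandMatrix]
  have h2 := Finset.sum_filter_add_sum_filter_not (Finset.range (s + q + s))
    (fun j => (i : ℕ) ≤ j + r ∧ j ≤ i + r) (fun j => l ^ endDist (s + q + s) s j)
  have h3 := sum_pow_endDist_excluded hr i.2 l
  have h4 := sum_pow_endDist s q l
  rw [hl, ← h2, add_mul, h3] at h4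
  rw [h1]
  linarith

theorem exp_le_permanent_bandMatrix {s q r : ℕ} (hr : r + 1 = s + q) (hs : 0 < s) {τ : ℝ}
    (hτ : 0 < τ) (heq : Real.exp τ + q * (1 - Real.exp (-(τ / s))) = 2) :
    Real.exp (-((s + q + s : ℕ) * Real.log (1 - Real.exp (-(τ / s)))) + (q - 2) * τ -
      (s + q + s : ℕ)) ≤ (bandMatrix (s + q + s) r).permanent := by
  set l := Real.exp (-(τ / s)) with hldef
  have hs' : (0 : ℝ) < s := Nat.cast_pos.2 hs
  have hl0 : 0 < l := Real.exp_pos _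
  have hl1 : 0 < 1 - l := by
    have : l < 1 := Real.exp_lt_one_iff.2 (neg_lt_zero.2 (div_pos hτ hs'))
    linarith
  have hls : l ^ s = Real.exp (-τ) := by
    rw [hldef, ← Real.exp_nat_mul]
    congr 1
    field_simp
  have hl : 2 * (1 - l ^ s) + q * (1 - l) * l ^ s = 1 := by
    have h : Real.exp τ * Real.exp (-τ) = 1 := by rw [← Real.exp_add]; simp
    rw [hls]
    linear_combination Real.exp (-τ) * heq - h
  have hle (i : ℕ) : endDist (s + q + s) s i ≤ s := by unfold endDist; omega
  have hnn : ∀ i j, 0 ≤ bandMatrix (s + q + s) r i j := fun i j => by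
    simp only [bandMatrix, Matrix.of_apply]
    split_ifs <;> norm_num
  have hsymm : ∀ i j, bandMatrix (s + q + s) r i j = bandMatrix (s + q + s) r j i := fun i j => by
    simp only [bandMatrix, Matrix.of_apply, and_comm]
  set g : Fin (s + q + s) → ℝ := fun i => (1 - l) / l ^ s * l ^ endDist (s + q + s) s i with hg
  set h : Fin (s + q + s) → ℝ := fun j => l ^ endDist (s + q + s) s j with hh
  have hrow : ∀ i, ∑ j, g i * bandMatrix (s + q + s) r i j * h j = 1 := fun i => by
    have e : l ^ s = l ^ endDist (s + q + s) s i * l ^ (s - endDist (s + q + s) s i) := by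
      rw [← pow_add, Nat.add_sub_cancel' (hle i)]
    simp only [mul_assoc, ← Finset.mul_sum, hg, hh]
    have key := sum_bandMatrix_mul_pow hr hl i
    rw [div_mul_eq_mul_div, div_eq_one_iff_eq (pow_pos hl0 s).ne']
    rw [e, ← key]
    ring
  have hcol : ∀ j, ∑ i, g i * bandMatrix (s + q + s) r i j * h j = 1 := fun j => by
    rw [← hrow j]
    refine Finset.sum_congr rfl fun i _ => ?_
    rw [hsymm]
    simp only [hg, hh]
    ring
  have hgpos : ∀ i, 0 < g i := fun i => by positivity
  have hhpos : ∀ i, 0 < h i := fun i => by positivity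
  have : Nonempty (Fin (s + q + s)) := ⟨⟨0, by omega⟩⟩
  have hmain := capacity_le_permanent hnn
    (Finset.prod_pos fun i _ => inv_pos.2 (mul_pos (hgpos i) (hhpos i)))
    fun x hx => scaling_le_capacity hnn hgpos hhpos hrow hcol hx
  refine le_of_eq_of_le ?_ hmain
  have hlog (i : Fin (s + q + s)) : (g i * h i)⁻¹ =
      Real.exp (-Real.log (1 - l) - τ + 2 * (τ / s) * endDist (s + q + s) s i) := by
    have e1 : (1 - l) = Real.exp (Real.log (1 - l)) := (Real.exp_log hl1).symm
    simp only [hg, hh]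
    rw [hls, e1, hldef, ← Real.exp_nat_mul, ← Real.exp_sub, ← Real.exp_add, ← Real.exp_add,
      ← Real.exp_neg, ← hldef, ← e1]
    congr 1
    ring
  have hsumE : ((∑ i : Fin (s + q + s), endDist (s + q + s) s i : ℕ) : ℝ) + s = s * s + q * s := by
    rw [← Finset.sum_range (fun i => endDist (s + q + s) s i)]
    exact_mod_cast sum_endDist s q
  rw [Finset.prod_congr rfl fun i _ => hlog i, ← Real.exp_sum, ← Real.exp_add,
    Finset.sum_add_distrib, ← Finset.mul_sum, Finset.sum_const, Finset.card_univ,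
    Fintype.card_fin, nsmul_eq_mul]
  congr 1
  rw [← Nat.cast_sum, eq_sub_of_add_eq hsumE]
  push_cast
  field_simp
  ring

end Band

/-! ### Asymptotics of the bound -/

section Asymptotics

theorem exists_exp_add_eq_two {s q : ℝ} (hs : 0 < s) (hq : 0 ≤ q) :
    ∃ τ : ℝ, 0 < τ ∧ τ ≤ 1 ∧ Real.exp τ + q * (1 - Real.exp (-(τ / s))) = 2 := by
  have hc : ContinuousOn (fun x : ℝ => Real.exp x + q * (1 - Real.exp (-(x / s))))
      (Set.Icc 0 1) := by fun_prop
  have h1 : (2 : ℝ) ≤ Real.exp 1 + q * (1 - Real.exp (-(1 / s))) := by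
    have h2 := Real.add_one_le_exp (1 : ℝ)
    have h3 : Real.exp (-(1 / s)) ≤ 1 := Real.exp_le_one_iff.2 (by
      have := one_div_pos.2 hs
      linarith)
    nlinarith
  obtain ⟨τ, hτ, hτ'⟩ := intermediate_value_Icc zero_le_one hc (show (2 : ℝ) ∈ _ from
    ⟨by norm_num, h1⟩)
  refine ⟨τ, lt_of_le_of_ne hτ.1 ?_, hτ.2, hτ'⟩
  rintro rfl
  norm_num at hτ'

/-- The root `τ` of the discrete equation is within `O(1 / s)` of the root `t` of its limit. -/
theorem abs_sub_root_le {s κ τ t : ℝ} (hs : 0 < s) (hκ : 0 ≤ κ) (hτ : 0 < τ) (hτ1 : τ ≤ 1)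
    (ht : 0 < t) (heq : Real.exp τ + (κ * s + 1) * (1 - Real.exp (-(τ / s))) = 2)
    (hteq : Real.exp t + κ * t = 2) : |τ - t| ≤ (κ + 1) / s := by
  set x := τ / s with hx
  have hx0 : 0 < x := div_pos hτ hs
  have hxs : x * s = τ := by rw [hx]; field_simp
  have hup : 1 - Real.exp (-x) ≤ x := by linarith [Real.add_one_le_exp (-x)]
  have hnn : 0 ≤ 1 - Real.exp (-x) := by
    have := Real.exp_le_one_iff.2 (neg_nonpos.2 hx0.le)
    linarith
  have hlow : x - x ^ 2 ≤ 1 - Real.exp (-x) := by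
    have h1 : Real.exp (-x) * (x + 1) ≤ 1 := by
      calc _ ≤ Real.exp (-x) * Real.exp x :=
            mul_le_mul_of_nonneg_left (Real.add_one_le_exp x) (Real.exp_pos _).le
        _ = 1 := by rw [← Real.exp_add]; simp
    nlinarith [pow_pos hx0 3, Real.exp_pos (-x)]
  have hslope {a b : ℝ} (ha : 0 < a) (hab : a ≤ b) : b - a ≤ Real.exp b - Real.exp a := by
    have h1 := Real.add_one_le_exp (b - a)
    have h2 : Real.exp b = Real.exp a * Real.exp (b - a) := by rw [← Real.exp_add]; ring_nf
    have h3 : 1 ≤ Real.exp a := Real.one_le_exp ha.le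
    nlinarith
  have hgoal : |τ - t| * s ≤ κ + 1 := by
    rcases le_total t τ with h | h
    · rw [abs_of_nonneg (by linarith)]
      have h1 := hslope ht h
      have h2 : κ * s * (x - x ^ 2) ≤ (κ * s + 1) * (1 - Real.exp (-x)) := by
        have := mul_le_mul_of_nonneg_left hlow (mul_nonneg hκ hs.le)
        linarith
      have h3 : κ * s * (x - x ^ 2) = κ * τ - κ * τ * x := by rw [← hxs]; ring
      have h4 : τ - t ≤ κ * τ * x := by nlinarith
      calc (τ - t) * s ≤ κ * τ * x * s := mul_le_mul_of_nonneg_right h4 hs.le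
        _ = κ * τ ^ 2 := by rw [mul_assoc, hxs]; ring
        _ ≤ κ * 1 := mul_le_mul_of_nonneg_left (by nlinarith) hκ
        _ ≤ κ + 1 := by linarith
    · rw [abs_of_nonpos (by linarith)]
      have h1 := hslope hτ h
      have h2 : (κ * s + 1) * (1 - Real.exp (-x)) ≤ (κ * s + 1) * x :=
        mul_le_mul_of_nonneg_left hup (by positivity)
      have h3 : (κ * s + 1) * x = κ * τ + x := by rw [← hxs]; ring
      have h4 : -(τ - t) ≤ x := by nlinarith
      calc -(τ - t) * s ≤ x * s := mul_le_mul_of_nonneg_right h4 hs.le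
        _ = τ := hxs
        _ ≤ κ + 1 := by linarith
  rwa [le_div_iff₀ hs]

/-- In natural units, `tHat ρ` is the positive root of `exp t + κ * t = 2`. -/
theorem exists_tHat_eq {ρ : ℝ} (h : 1 / 2 < ρ) (h' : ρ < 1) :
    ∃ t : ℝ, 0 < t ∧ tHat ρ = t / Real.log 2 ∧
      Real.exp t + (2 * ρ - 1) / (1 - ρ) * t = 2 := by
  have hd : 0 < 2 * ρ - 1 := by linarith
  have hs : 0 < 1 - ρ := by linarith
  have hlog : 0 < Real.log 2 := Real.log_pos (by norm_num)
  have hz : 0 ≤ (1 - ρ) * Real.exp (2 * (1 - ρ) / (2 * ρ - 1)) / (2 * ρ - 1) := by positivity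
  obtain ⟨h0, h1⟩ := lambertW_spec hz
  set W := lambertW ((1 - ρ) * Real.exp (2 * (1 - ρ) / (2 * ρ - 1)) / (2 * ρ - 1)) with hW
  have htHat : tHat ρ = (2 * (1 - ρ) / (2 * ρ - 1) - W) / Real.log 2 := by
    rw [tHat, ← hW, Real.logb, Real.log_exp]
    ring
  refine ⟨2 * (1 - ρ) / (2 * ρ - 1) - W, ?_, htHat, ?_⟩
  · have := tHat_pos h h'
    rw [htHat] at this
    exact (div_pos_iff_of_pos_right hlog).1 this
  · rw [Real.exp_sub]
    have hE := Real.exp_pos W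
    generalize Real.exp (2 * (1 - ρ) / (2 * ρ - 1)) = E at h1 ⊢
    have hE' : E / Real.exp W = W * (2 * ρ - 1) / (1 - ρ) := by
      have h2 : W * Real.exp W * (2 * ρ - 1) = (1 - ρ) * E := by
        rw [h1, div_mul_cancel₀ _ hd.ne']
      rw [div_eq_div_iff hE.ne' hs.ne']
      linarith
    rw [hE']
    field_simp
    ring

theorem logPhi3Main_eq {ρ t : ℝ} (ht : tHat ρ = t / Real.log 2) (ht0 : 0 < t) (n : ℕ) :
    logPhi3Main ρ n * Real.log 2 =
      n * Real.log n - n * (1 + Real.log t - t * (2 * ρ - 1) - Real.log (1 - ρ)) := by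
  have hlog : 0 < Real.log 2 := Real.log_pos (by norm_num)
  have e : Real.exp 1 * tHat ρ / Real.logb 2 (Real.exp 1) = Real.exp 1 * t := by
    rw [ht, Real.logb, Real.log_exp]
    field_simp
  rw [logPhi3Main, e, ht]
  simp only [Real.logb]
  rw [Real.log_mul (Real.exp_pos 1).ne' ht0.ne', Real.log_exp]
  field_simp

/-- The logarithm of the lower bound for the permanent of the band matrix agrees with
`logPhi3Main` up to a constant. -/
theorem exists_logPhi3Main_le {ρ : ℝ} (hρ : 1 / 2 < ρ) (hρ' : ρ < 1) :
    ∃ K : ℝ, ∀ n r : ℕ, 2 ≤ n → (r : ℝ) = ρ * ((n : ℝ) - 1) →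
      Real.exp (logPhi3Main ρ n * Real.log 2 - K) ≤ (bandMatrix n r).permanent := by
  obtain ⟨t, ht, htHat, hteq⟩ := exists_tHat_eq hρ hρ'
  set κ := (2 * ρ - 1) / (1 - ρ) with hκdef
  have hd : 0 < 2 * ρ - 1 := by linarith
  have hρs : 0 < 1 - ρ := by linarith
  have hκ : 0 < κ := div_pos hd hρs
  refine ⟨4 + 2 * (κ + 1) / (1 - ρ) * (1 / t + (2 * ρ - 1)), fun n r hn hr => ?_⟩
  have hn2 : (2 : ℝ) ≤ n := by exact_mod_cast hn
  have hrn : r + 1 < n + 0 := by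
    have : (r : ℝ) + 1 < n := by nlinarith
    exact_mod_cast this
  obtain ⟨s, rfl⟩ : ∃ s, n = r + 1 + s := ⟨n - (r + 1), by omega⟩
  have hs : 0 < s := by omega
  have hs' : (0 : ℝ) < s := Nat.cast_pos.2 hs
  push_cast at hr hn2
  have hsr : s ≤ r + 1 := by
    have : (s : ℝ) ≤ r + 1 := by nlinarith
    exact_mod_cast this
  obtain ⟨q, hq⟩ : ∃ q, r + 1 = s + q := ⟨r + 1 - s, by omega⟩
  have hq' : (r : ℝ) + 1 = s + q := by exact_mod_cast hq
  rw [hq]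
  have hN : ((s + q + s : ℕ) : ℝ) = r + 1 + s := by push_cast; linarith
  set N : ℝ := ((s + q + s : ℕ) : ℝ) with hNdef
  have hsN : (s : ℝ) = (1 - ρ) * (N - 1) := by rw [hN]; linarith
  have hqN : (q : ℝ) = (2 * ρ - 1) * (N - 1) + 1 := by rw [hN]; linarith
  have hqs : (q : ℝ) = κ * s + 1 := by
    rw [hqN, hsN, hκdef]
    field_simp
  obtain ⟨τ, hτ, hτ1, heq⟩ := exists_exp_add_eq_two hs' (Nat.cast_nonneg q)
  refine le_trans (Real.exp_le_exp.2 ?_) (exp_le_permanent_bandMatrix hq hs hτ heq)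
  rw [hqs] at heq
  have hdist := abs_sub_root_le hs' hκ.le hτ hτ1 ht heq hteq
  rw [logPhi3Main_eq htHat ht, ← hNdef]
  have hN2 : 2 ≤ N := by rw [hN]; exact_mod_cast hn2
  have hN1 : 0 < N - 1 := by linarith
  have hx : 0 < τ / s := div_pos hτ hs'
  have hlog1 : Real.log (1 - Real.exp (-(τ / s))) ≤ Real.log τ - Real.log s := by
    rw [← Real.log_div hτ.ne' hs'.ne']
    refine Real.log_le_log ?_ ?_
    · have := Real.exp_lt_one_iff.2 (neg_lt_zero.2 hx)
      linarith
    · linarith [Real.add_one_le_exp (-(τ / s))]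
  have hlogs : Real.log s = Real.log (1 - ρ) + Real.log (N - 1) := by
    rw [hsN, Real.log_mul hρs.ne' hN1.ne']
  have hlogN : N * Real.log N - N * Real.log (N - 1) ≤ 2 := by
    have h1 := Real.log_le_sub_one_of_pos (div_pos (by linarith : 0 < N) hN1)
    rw [Real.log_div (by linarith) hN1.ne'] at h1
    have h2 : N * (N / (N - 1) - 1) ≤ 2 := by
      rw [show N * (N / (N - 1) - 1) = N / (N - 1) by field_simp; ring, div_le_iff₀ hN1]
      linarith
    nlinarith
  have hlogt : Real.log τ - Real.log t ≤ (τ - t) / t := by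
    have h1 := Real.log_le_sub_one_of_pos (div_pos hτ ht)
    rw [Real.log_div hτ.ne' ht.ne'] at h1
    calc _ ≤ _ := h1
      _ = _ := by field_simp
  have hND : N * |τ - t| ≤ 2 * (κ + 1) / (1 - ρ) := by
    calc N * |τ - t| ≤ N * ((κ + 1) / s) := mul_le_mul_of_nonneg_left hdist (by linarith)
      _ ≤ (2 * (N - 1)) * ((κ + 1) / s) :=
          mul_le_mul_of_nonneg_right (by linarith) (by positivity)
      _ = _ := by rw [hsN]; field_simp
  have h5 : N * ((τ - t) / t) ≤ 2 * (κ + 1) / (1 - ρ) * (1 / t) := by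
    calc N * ((τ - t) / t) = N * (τ - t) * (1 / t) := by ring
      _ ≤ N * |τ - t| * (1 / t) := by
          gcongr
          exact le_abs_self _
      _ ≤ _ := mul_le_mul_of_nonneg_right hND (by positivity)
  have h6 : N * (t - τ) * (2 * ρ - 1) ≤ 2 * (κ + 1) / (1 - ρ) * (2 * ρ - 1) := by
    refine mul_le_mul_of_nonneg_right (le_trans ?_ hND) hd.le
    rw [abs_sub_comm]
    exact mul_le_mul_of_nonneg_left (le_abs_self _) (by linarith)
  have h7 := mul_le_mul_of_nonneg_left hlog1 (by linarith : 0 ≤ N)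
  have h8 := mul_le_mul_of_nonneg_left hlogt (by linarith : 0 ≤ N)
  have h9 : ρ * τ ≤ 1 := by nlinarith
  rw [hlogs] at h7
  rw [hqN]
  set D := 2 * (κ + 1) / (1 - ρ)
  set L := Real.log (1 - Real.exp (-(τ / s)))
  linarith

end Asymptotics

theorem mainTheorem5 (ρ : ℝ) (hρ : 1 / 2 < ρ) (hρ' : ρ < 1) :
    ∃ φ₃ : ℕ → ℝ,
      (∀ n : ℕ, 0 < φ₃ n) ∧
      ((fun n : ℕ => Real.logb 2 (φ₃ n) - logPhi3Main ρ n) =o[atTop] fun n : ℕ => (n : ℝ)) ∧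
      ∀ n r : ℕ, 0 < n → (r : ℝ) = ρ * ((n : ℝ) - 1) →
        ∀ f : Equiv.Perm (Fin n), φ₃ n ≤ ((permBall n r f).card : ℝ) := by
  obtain ⟨K, hK⟩ := exists_logPhi3Main_le hρ hρ'
  -- The maximum takes care of `n = 1`, where the ball has one element.
  set K' := max K (logPhi3Main ρ 1 * Real.log 2) with hK'
  have hlog : 0 < Real.log 2 := Real.log_pos (by norm_num)
  refine ⟨fun n => Real.exp (logPhi3Main ρ n * Real.log 2 - K'), fun n => Real.exp_pos _, ?_, ?_⟩
  · have hconst : (fun n : ℕ => Real.logb 2 (Real.exp (logPhi3Main ρ n * Real.log 2 - K')) -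
        logPhi3Main ρ n) = fun _ => -K' / Real.log 2 := by
      ext n
      rw [Real.logb, Real.log_exp]
      field_simp
      ring
    rw [hconst, isLittleO_const_left]
    exact Or.inr (tendsto_norm_atTop_atTop.comp tendsto_natCast_atTop_atTop)
  · intro n r hn hr f
    rcases Nat.lt_or_ge n 2 with h | h
    · obtain rfl : n = 1 := by omega
      have hmem : f ∈ permBall 1 r f := 
        Finset.mem_filter.2 ⟨Finset.mem_univ f, Finset.sup_le fun i _ => by simp⟩
      calc Real.exp (logPhi3Main ρ 1 * Real.log 2 - K') ≤ Real.exp 0 :=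
            Real.exp_le_exp.2 (sub_nonpos.2 (le_max_right _ _))
        _ = ((1 : ℕ) : ℝ) := by simp
        _ ≤ _ := Nat.cast_le.2 (Finset.card_pos.2 ⟨f, hmem⟩)
    · rw [card_permBall]
      exact (Real.exp_le_exp.2 (sub_le_sub_left (le_max_left _ _) _)).trans (hK n r h hr)
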